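/- For metric spaces $X$ and $Y$, a subset of $X$ is a copy of $Y$ if it is the image of $Y$ under a distance-preserving map, and $\chi(X,Y)$ denotes the smallest $k$ such that the points of $X$ can be coloured with $k$ colours with no monochromatic copy of $Y$ (with $\chi(X,Y)=\infty$ if there is no such $k$). Let $\mathbb R^n_\infty$ be $\mathbb R^n$ with the maximum metric, and for $q>0$ let $\mathcal G(q)=\{0,\,1,\,1+q,\,1+q+q^2,\,\ldots\}\subset\mathbb R$ with the standard metric of $\mathbb R$. A copy $\mathcal C\subset\mathbb R^n_\infty$ of $\mathcal G(q)$ is called proper if for some $i\in\{1,\ldots,n\}$ the set of $i$-th coordinates of the points of $\mathcal C$ is a translate of $-\mathcal G(q)$. A metric space $\mathcal M$ is called $\ell_\infty$-Ramsey if $\chi(\mathbb R^n_\infty,\mathcal M)\to\infty$ as $n\to\infty$. (1) For every $0<\varepsilon<\frac12$ there exists $q_0>0$ such that for all $0<q\le q_0$ and all $k\in\mathbb N$, every $k$-colouring of the cube $[-\varepsilon,1+\varepsilon]^{3^k}$ with the maximum metric contains a monochromatic proper copy of $\mathcal G(q)$. (2) There exists $q_0>0$ such that for all $0<q\le q_0$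 and all integers $n\ge1$, $$\chi(\mathbb R^n_\infty,\mathcal G(q))>\log_3 n.$$ (3) Consequently, an infinite $\ell_\infty$-Ramsey metric space exists. -/

import Mathlib

open Set Filter Topology
open scoped ENNReal

/-- `C` is a copy of the metric space `Y` inside the metric space `X`: there is a
distance-preserving bijection from `Y` onto `C`. -/
def IsCopy {X : Type*} [MetricSpace X] (Y : Type*) [MetricSpace Y] (C : Set X) : Prop :=
  ∃ f : Y → X, Isometry f ∧ Set.range f = C

/-- All points of `C` receive the same colour under `c`. -/
def IsMonochromatic {X κ : Type*} (c : X → κ) (C : Set X) : Prop :=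
  ∃ a : κ, ∀ x ∈ C, c x = a

/-- `X` can be coloured with `k` colours without a monochromatic copy of `Y`. -/
def AvoidsWithColours (X : Type*) [MetricSpace X] (Y : Type*) [MetricSpace Y] (k : ℕ) : Prop :=
  ∃ c : X → Fin k, ∀ C : Set X, IsCopy Y C → ¬ IsMonochromatic c C

/-- The chromatic number of `X` with forbidden subspace `Y`: the smallest `k` such that `X` can be
coloured with `k` colours without a monochromatic copy of `Y` (and `⊤` if there is no such `k`). -/
noncomputable def metricChromaticNumber (X : Type*) [MetricSpace X] (Y : Type*) [MetricSpace Y] :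
    ℕ∞ :=
  ⨅ (k : ℕ) (_ : AvoidsWithColours X Y k), (k : ℕ∞)

/-- `Y` is `ℓ_∞`-Ramsey: the chromatic number of `ℝⁿ` with the maximum metric (the metric that
`Fin n → ℝ` carries) and forbidden subspace `Y` tends to infinity with `n`. -/
def IsLInftyRamsey (Y : Type*) [MetricSpace Y] : Prop :=
  Tendsto (fun n : ℕ => metricChromaticNumber (Fin n → ℝ) Y) atTop (𝓝 ⊤)

/-- The geometric progression `{0, 1, 1 + q, 1 + q + q², …}`, with the metric of the real line. -/
def geomProg (q : ℝ) : Set ℝ :=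
  Set.range fun m : ℕ => ∑ i ∈ Finset.range m, q ^ i

/-- `C ⊆ ℝⁿ` is a proper isometric copy of `geomProg q`: it is a copy and, for some `i`, the
`i`-th coordinates of its points form a translation of `-geomProg q`. -/
def IsProperCopy {n : ℕ} (q : ℝ) (C : Set (Fin n → ℝ)) : Prop :=
  IsCopy (geomProg q) C ∧
    ∃ (i : Fin n) (a : ℝ), (fun x : Fin n → ℝ => x i) '' C = (fun g : ℝ => a - g) '' geomProg q

/-- The cube `[-ε, 1 + ε]ⁿ`. -/
def epsCube (n : ℕ) (ε : ℝ) : Set (Fin n → ℝ) :=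
  {x | ∀ i, x i ∈ Set.Icc (-ε) (1 + ε)}

/- Split `ℝ^{3n}` into three blocks `ℝⁿ`. The argument is by induction on the number of colours. At
every scale `q ^ j` consider the cells: one of the blocks `1`, `2` is pinned, and the other two
vary by slightly more than `q ^ j / 2` around a centre. Points of two consecutive cells with the
same centre differ by at most `q ^ j` in the unpinned blocks, so a sequence with one point in each
cell has the distances of `geomProg q` as soon as the pinned block has them.

If the cells of all scales meet all colours, such a sequence can be chosen in any colour. Otherwise
take the first scale `q ^ m` with a cell missing a colour. It contains a cube of side about `q ^ m`
in one of its unpinned blocks, where induction gives a monochromatic progression with first step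
`q ^ m`. If `m = 0` this is the desired one. If `m > 0`, pin the block of that progression instead:
the missing first points, with steps `1, q, …, q ^ (m - 1)`, are found in cells of scales below `m`,
all of which meet all colours. -/

lemma IsCopy.image {X Y Z : Type*} [MetricSpace X] [MetricSpace Y] [MetricSpace Z] {C : Set X}
    (hC : IsCopy Y C) {g : X → Z} (hg : Isometry g) : IsCopy Y (g '' C) := by
  obtain ⟨f, hf, rfl⟩ := hC
  exact ⟨g ∘ f, hg.comp hf, range_comp g f⟩

lemma IsMonochromatic.image {X Z κ : Type*} {c : Z → κ} {g : X → Z} {C : Set X}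
    (hC : IsMonochromatic (c ∘ g) C) : IsMonochromatic c (g '' C) := by
  obtain ⟨a, ha⟩ := hC
  exact ⟨a, forall_mem_image.2 ha⟩

section chromaticNumber

variable {X Y Z : Type*} [MetricSpace X] [MetricSpace Y] [MetricSpace Z] {k l : ℕ}

lemma AvoidsWithColours.mono [Nonempty Y] (h : AvoidsWithColours X Y k) (hkl : k ≤ l) :
    AvoidsWithColours X Y l := by
  obtain ⟨c, hc⟩ := h
  refine ⟨Fin.castLE hkl ∘ c, ?_⟩
  rintro _ ⟨f, hf, rfl⟩ ⟨a, ha⟩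
  obtain ⟨y⟩ := ‹Nonempty Y›
  exact hc _ ⟨f, hf, rfl⟩ ⟨c (f y), fun x hx ↦
    Fin.castLE_injective hkl ((ha x hx).trans (ha _ (mem_range_self y)).symm)⟩

lemma AvoidsWithColours.of_isometry (h : AvoidsWithColours Z Y k) {g : X → Z} (hg : Isometry g) :
    AvoidsWithColours X Y k := by
  obtain ⟨c, hc⟩ := h
  exact ⟨c ∘ g, fun C hC hmono ↦ hc (g '' C) (hC.image hg) hmono.image⟩

lemma lt_metricChromaticNumber [Nonempty Y] (h : ¬ AvoidsWithColours X Y k) :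
    (k : ℕ∞) < metricChromaticNumber X Y := by
  rw [← ENat.add_one_le_iff (ENat.natCast_ne_top k)]
  refine le_iInf₂ fun l hl ↦ ?_
  by_contra! hlt
  have hlk : l ≤ k := Nat.lt_succ_iff.1 (by exact_mod_cast hlt)
  exact h (hl.mono hlk)

lemma metricChromaticNumber_le_of_isometry {g : X → Z} (hg : Isometry g) :
    metricChromaticNumber X Y ≤ metricChromaticNumber Z Y :=
  le_iInf₂ fun k hk ↦ iInf₂_le k (hk.of_isometry hg)

end chromaticNumber

lemma isometry_comp_of_surjective {ι ι' X : Type*} [Fintype ι] [Fintype ι'] [PseudoMetricSpace X]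
    {σ : ι' → ι} (hσ : Function.Surjective σ) : Isometry fun x : ι → X ↦ x ∘ σ := by
  refine Isometry.of_dist_eq fun x y ↦ le_antisymm ?_ ?_
  · exact (dist_pi_le_iff dist_nonneg).2 fun i ↦ dist_le_pi_dist x y (σ i)
  · refine (dist_pi_le_iff dist_nonneg).2 (hσ.forall.2 fun i ↦ ?_)
    exact dist_le_pi_dist (x ∘ σ) (y ∘ σ) i

lemma isometry_uncurry {ι ι' X : Type*} [Fintype ι] [Fintype ι'] [PseudoMetricSpace X] :
    Isometry (Function.uncurry : (ι → ι' → X) → ι × ι' → X) := by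
  refine Isometry.of_dist_eq fun x y ↦ le_antisymm ?_ ?_
  · refine (dist_pi_le_iff dist_nonneg).2 fun p ↦ ?_
    exact (dist_le_pi_dist (x p.1) (y p.1) p.2).trans (dist_le_pi_dist x y p.1)
  · refine (dist_pi_le_iff dist_nonneg).2 fun i ↦ (dist_pi_le_iff dist_nonneg).2 fun j ↦ ?_
    exact dist_le_pi_dist (Function.uncurry x) (Function.uncurry y) (i, j)

/-- A sequence whose `l`-th step has length at most `r l` and lowers the value of `φ` by exactly
`r l`. If `φ` is `1`-Lipschitz, then the distances between its points are those between the partial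
sums of `r`. -/
structure IsDescent {X : Type*} [PseudoMetricSpace X] (φ : X → ℝ) (r : ℕ → ℝ) (x : ℕ → X) :
    Prop where
  apply_succ : ∀ l, φ (x (l + 1)) = φ (x l) - r l
  dist_succ_le : ∀ l, dist (x l) (x (l + 1)) ≤ r l

namespace IsDescent

section metric

variable {X : Type*} [PseudoMetricSpace X] {φ : X → ℝ} {r : ℕ → ℝ} {x : ℕ → X}

lemma apply_eq_sub_sum (hx : IsDescent φ r x) (m : ℕ) :
    φ (x m) = φ (x 0) - ∑ l ∈ Finset.range m, r l := by
  induction m with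
  | zero => simp
  | succ m ih => rw [hx.apply_succ, ih, Finset.sum_range_succ, sub_sub]

lemma dist_eq (hx : IsDescent φ r x) (hφ : LipschitzWith 1 φ) (m n : ℕ) :
    dist (x m) (x n) = dist (∑ l ∈ Finset.range m, r l) (∑ l ∈ Finset.range n, r l) := by
  wlog hmn : m ≤ n generalizing m n
  · rw [dist_comm, this n m (by omega), dist_comm]
  apply le_antisymm
  · refine (dist_le_Ico_sum_of_dist_le hmn fun {l} _ _ ↦ hx.dist_succ_le l).trans ?_
    rw [Finset.sum_Ico_eq_sub _ hmn, dist_comm]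
    exact le_abs_self _
  · calc dist (∑ l ∈ Finset.range m, r l) (∑ l ∈ Finset.range n, r l)
        = dist (φ (x m)) (φ (x n)) := by
          rw [hx.apply_eq_sub_sum m, hx.apply_eq_sub_sum n, dist_sub_left]
      _ ≤ dist (x m) (x n) := by simpa using hφ.dist_le_mul (x m) (x n)

lemma map_isometry {Z : Type*} [PseudoMetricSpace Z] (hx : IsDescent φ r x) {ψ : Z → ℝ}
    {g : X → Z} (hg : Isometry g) (hψ : ∀ y, ψ (g y) = φ y) : IsDescent ψ r fun l ↦ g (x l) where
  apply_succ l := by simp only [hψ, hx.apply_succ]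
  dist_succ_le l := by simpa only [hg.dist_eq] using hx.dist_succ_le l

end metric

section pi

variable {ι : Type*} [Fintype ι] {i : ι} {r : ℕ → ℝ}

lemma add_smul_sub {t : ℕ → ι → ℝ} (ht : IsDescent (fun u ↦ u i) r t) {s : ℝ} (hs : 0 ≤ s)
    (b p : ι → ℝ) : IsDescent (fun u ↦ u i) (fun l ↦ s * r l) fun l ↦ b + s • (t l - p) where
  apply_succ l := by
    simp only [Pi.add_apply, Pi.smul_apply, Pi.sub_apply, smul_eq_mul, ht.apply_succ]
    ring
  dist_succ_le l := by
    rw [dist_add_left, dist_smul₀, dist_sub_right, Real.norm_of_nonneg hs]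
    exact mul_le_mul_of_nonneg_left (ht.dist_succ_le l) hs

/-- The truncated subtraction makes the sequence wait at `w 0` for the first `m` terms. -/
lemma prolong [DecidableEq ι] {m : ℕ} {w : ℕ → ι → ℝ} (hr : ∀ l, 0 ≤ r l)
    (hw : IsDescent (fun u ↦ u i) (fun l ↦ r (m + l)) w) :
    IsDescent (fun u ↦ u i) r fun j ↦ w (j - m) + Pi.single i (∑ l ∈ Finset.Ico j m, r l) := by
  have hlt : ∀ j < m, w (j - m) + Pi.single i (∑ l ∈ Finset.Ico j m, r l) =
      w (j + 1 - m) + Pi.single i (∑ l ∈ Finset.Ico (j + 1) m, r l) + Pi.single i (r j) := by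
    intro j hj
    rw [Nat.sub_eq_zero_of_le hj.le, Nat.sub_eq_zero_of_le hj, Finset.sum_eq_sum_Ico_succ_bot hj,
      add_comm (r j), Pi.single_add, add_assoc]
  have hge : ∀ j ≥ m, w (j - m) + Pi.single i (∑ l ∈ Finset.Ico j m, r l) = w (j - m) := by
    intro j hj
    simp [Finset.Ico_eq_empty_of_le hj]
  constructor <;> intro j <;> rcases lt_or_ge j m with hj | hj
  · rw [hlt j hj]
    simp
  · have := hw.apply_succ (j - m)
    rwa [hge j hj, hge (j + 1) (by omega), Nat.sub_add_comm hj, ← Nat.add_sub_of_le hj,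
      Nat.add_sub_cancel_left]
  · rw [hlt j hj, dist_self_add_left, Pi.norm_single, Real.norm_of_nonneg (hr j)]
  · have := hw.dist_succ_le (j - m)
    rwa [Nat.add_sub_of_le hj, ← Nat.sub_add_comm hj, ← hge j hj, ← hge (j + 1) (by omega)] at this

end pi

end IsDescent

section geomProg

variable {q : ℝ}

lemma strictMono_geomSum (hq : 0 < q) : StrictMono fun m : ℕ ↦ ∑ l ∈ Finset.range m, q ^ l :=
  strictMono_nat_of_lt_succ fun m ↦ by
    rw [Finset.sum_range_succ]
    exact lt_add_of_pos_right _ (pow_pos hq m)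

lemma infinite_geomProg (hq : 0 < q) : Infinite (geomProg q) :=
  (infinite_range_of_injective (strictMono_geomSum hq).injective).to_subtype

lemma IsDescent.isCopy_range {X : Type*} [MetricSpace X] {φ : X → ℝ} {x : ℕ → X}
    (hx : IsDescent φ (q ^ ·) x) (hφ : LipschitzWith 1 φ) (hq : 0 < q) :
    IsCopy (geomProg q) (range x) := by
  let e : ℕ ≃ geomProg q := Equiv.ofInjective _ (strictMono_geomSum hq).injective
  refine ⟨x ∘ e.symm, Isometry.of_dist_eq ?_, e.symm.surjective.range_comp x⟩
  refine e.surjective.forall₂.2 fun m n ↦ ?_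
  simpa using! hx.dist_eq hφ m n

lemma IsDescent.isProperCopy_range {n : ℕ} {i : Fin n} {x : ℕ → Fin n → ℝ}
    (hx : IsDescent (fun u ↦ u i) (q ^ ·) x) (hq : 0 < q) : IsProperCopy q (range x) := by
  refine ⟨hx.isCopy_range (LipschitzWith.eval i) hq, i, x 0 i, ?_⟩
  rw [geomProg, ← range_comp, ← range_comp]
  exact congrArg range (funext hx.apply_eq_sub_sum)

end geomProg

/-- Some descent with steps `1, q, q², …` along one of the functions `coord i` stays in `Q`. -/
def ContainsDescent {X I : Type*} [PseudoMetricSpace X] (coord : I → X → ℝ) (q : ℝ) (Q : Set X) :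
    Prop :=
  ∃ (i : I) (x : ℕ → X), IsDescent (coord i) (q ^ ·) x ∧ ∀ l, x l ∈ Q

/-- Every colouring by elements of `κ` that uses at most `k` colours on `Q` has a monochromatic
descent in `Q`. Counting the colours used, rather than those available, makes the induction on `k`
possible without relabelling. -/
def HasMonochromaticDescent (κ : Type*) {X I : Type*} [PseudoMetricSpace X] (coord : I → X → ℝ)
    (q : ℝ) (Q : Set X) (k : ℕ) : Prop :=
  ∀ c : X → κ, (c '' Q).encard ≤ k → ∃ a, ContainsDescent coord q (Q ∩ c ⁻¹' {a})

lemma HasMonochromaticDescent.map_isometry {κ X Z I J : Type*} [PseudoMetricSpace X]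
    [PseudoMetricSpace Z] {coord : I → X → ℝ} {coord' : J → Z → ℝ} {q : ℝ} {Q : Set X} {R : Set Z}
    {k : ℕ} (hQ : HasMonochromaticDescent κ coord q Q k) {g : X → Z} (hg : Isometry g)
    (hQR : MapsTo g Q R) (e : I → J) (he : ∀ i x, coord' (e i) (g x) = coord i x) :
    HasMonochromaticDescent κ coord' q R k := by
  intro c hc
  have himage : (c ∘ g) '' Q ⊆ c '' R := by
    rw [image_comp]
    exact image_mono hQR.image_subset
  obtain ⟨a, i, x, hx, hxQ⟩ := hQ (c ∘ g) ((encard_le_encard himage).trans hc)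
  exact ⟨a, e i, fun l ↦ g (x l), hx.map_isometry hg (he i), fun l ↦
    ⟨hQR (hxQ l).1, (hxQ l).2⟩⟩

/-- The common ratio `q` is small in terms of the enlargement `ε` of the cube. -/
structure SmallRatio (ε q : ℝ) : Prop where
  eps_pos : 0 < ε
  eps_lt : ε < 1 / 2
  pos : 0 < q
  five_mul_le : 5 * q ≤ ε
  le_half_sub : q ≤ 1 / 2 - ε

lemma exists_smallRatio {ε : ℝ} (hε : 0 < ε) (hε' : ε < 1 / 2) :
    ∃ q₀ : ℝ, 0 < q₀ ∧ ∀ q : ℝ, 0 < q → q ≤ q₀ → SmallRatio ε q := by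
  refine ⟨min (ε / 5) (1 / 2 - ε), lt_min (by linarith) (by linarith), fun q hq hle ↦ ?_⟩
  obtain ⟨hle₁, hle₂⟩ := le_min_iff.1 hle
  exact ⟨hε, hε', hq, by linarith, hle₂⟩

namespace SmallRatio

variable {ε q : ℝ}

lemma le_one_tenth (h : SmallRatio ε q) : q ≤ 1 / 10 := by
  linarith [h.five_mul_le, h.eps_lt]

lemma lt_one (h : SmallRatio ε q) : q < 1 := by
  linarith [h.le_one_tenth]

lemma pow_le_pow (h : SmallRatio ε q) {j m : ℕ} (hjm : j ≤ m) : q ^ m ≤ q ^ j :=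
  pow_le_pow_of_le_one h.pos.le h.lt_one.le hjm

lemma radius_add_radius_succ_le (h : SmallRatio ε q) (j : ℕ) :
    (1 / 2 + ε) * q ^ j + (1 / 2 + ε) * q ^ (j + 1) ≤ q ^ j := by
  have hprod : (1 / 2 + ε) * (1 + q) ≤ 1 := by
    nlinarith [h.le_half_sub, h.eps_pos, sq_nonneg (ε - 1 / 2)]
  calc (1 / 2 + ε) * q ^ j + (1 / 2 + ε) * q ^ (j + 1) = (1 / 2 + ε) * (1 + q) * q ^ j := by ring
    _ ≤ q ^ j := mul_le_of_le_one_left (pow_nonneg h.pos.le j) hprod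

lemma tail_le (h : SmallRatio ε q) (j : ℕ) : q ^ j / (1 - q) ≤ (1 + 2 * q) * q ^ j := by
  have hprod : 1 ≤ (1 + 2 * q) * (1 - q) := by nlinarith [h.pos, h.le_one_tenth]
  rw [div_le_iff₀ (by linarith [h.lt_one])]
  nlinarith [pow_pos h.pos j]

lemma tail_nonneg (h : SmallRatio ε q) (j : ℕ) : 0 ≤ q ^ j / (1 - q) :=
  div_nonneg (pow_nonneg h.pos.le j) (by linarith [h.lt_one])

lemma tail_succ (h : SmallRatio ε q) (j : ℕ) :
    q ^ (j + 1) / (1 - q) = q ^ j / (1 - q) - q ^ j := by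
  have : 1 - q ≠ 0 := by linarith [h.lt_one]
  field_simp
  ring

lemma isDescent_single_tail {ι : Type*} [Fintype ι] [DecidableEq ι] (h : SmallRatio ε q) (i : ι) :
    IsDescent (fun u : ι → ℝ ↦ u i) (q ^ ·) fun j ↦ Pi.single i (q ^ j / (1 - q)) where
  apply_succ j := by simp [h.tail_succ]
  dist_succ_le j := by
    rw [h.tail_succ, Pi.single_sub, dist_self_sub_right, Pi.norm_single,
      Real.norm_of_nonneg (pow_nonneg h.pos.le j)]

end SmallRatio

section cube

variable {ι : Type*} {ε q s : ℝ}

/-- The cube `[-ε, 1 + ε]^ι` scaled by `s` about the origin. -/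
def cube (ι : Type*) (ε s : ℝ) : Set (ι → ℝ) :=
  {u | ∀ i, u i ∈ Icc (-(ε * s)) ((1 + ε) * s)}

lemma cube_one_eq_epsCube (n : ℕ) (ε : ℝ) : cube (Fin n) ε 1 = epsCube n ε := by
  simp only [cube, epsCube, mul_one]

lemma cube_mono (hε : 0 ≤ ε) {s' : ℝ} (hs : s ≤ s') : cube ι ε s ⊆ cube ι ε s' :=
  fun _ hu i ↦ Icc_subset_Icc (by gcongr) (by gcongr) (hu i)

lemma zero_mem_cube (hε : 0 ≤ ε) (hs : 0 ≤ s) : (0 : ι → ℝ) ∈ cube ι ε s :=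
  fun _ ↦ ⟨neg_nonpos.2 (by positivity), by simp only [Pi.zero_apply]; positivity⟩

lemma half_mem_cube_one (hε : 0 ≤ ε) : (fun _ ↦ 1 / 2) ∈ cube ι ε 1 :=
  fun _ ↦ ⟨by linarith, by linarith⟩

/-- The similarity of ratio `s` that sends the centre of `[0, 1]^ι` to `b`. -/
noncomputable def rescale (s : ℝ) (b t : ι → ℝ) : ι → ℝ :=
  b + s • (t - fun _ ↦ 1 / 2)

lemma rescale_one_half (t : ι → ℝ) : rescale 1 (fun _ ↦ 1 / 2) t = t := by
  simp [rescale]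

lemma abs_rescale_sub_le (hs : 0 ≤ s) (b : ι → ℝ) {t : ι → ℝ} (ht : t ∈ cube ι ε 1) (i : ι) :
    |rescale s b t i - b i| ≤ (1 / 2 + ε) * s := by
  have hcentre : |t i - 1 / 2| ≤ 1 / 2 + ε := by
    obtain ⟨hlo, hhi⟩ := ht i
    exact abs_le.2 ⟨by linarith, by linarith⟩
  calc |rescale s b t i - b i| = |t i - 1 / 2| * s := by
        simp [rescale, abs_mul, abs_of_nonneg hs, mul_comm]
    _ ≤ (1 / 2 + ε) * s := mul_le_mul_of_nonneg_right hcentre hs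

lemma abs_rescale_le (hε : ε ≤ 1 / 2) (hs : 0 ≤ s) {b t : ι → ℝ}
    (hb : b ∈ cube ι ε s) (ht : t ∈ cube ι ε 1) (i : ι) : |rescale s b t i| ≤ 3 * s := by
  have hb' : |b i| ≤ (1 + ε) * s := abs_le.2 ⟨by linarith [(hb i).1], (hb i).2⟩
  calc |rescale s b t i| ≤ |rescale s b t i - b i| + |b i| := by
        simpa using abs_add_le (rescale s b t i - b i) (b i)
    _ ≤ (1 / 2 + ε) * s + (1 + ε) * s := add_le_add (abs_rescale_sub_le hs b ht i) hb'
    _ ≤ 3 * s := by nlinarith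

lemma SmallRatio.add_single_mem_cube [DecidableEq ι] (h : SmallRatio ε q) (hs : 0 ≤ s)
    {w : ι → ℝ} (hw : ∀ l, |w l| ≤ 3 * q * s) {d : ℝ} (hd : 0 ≤ d) (hd' : d ≤ (1 + 2 * q) * s)
    (i : ι) : w + Pi.single i d ∈ cube ι ε s := by
  have hqs : 5 * q * s ≤ ε * s := mul_le_mul_of_nonneg_right h.five_mul_le hs
  have hqs' : 0 ≤ q * s := mul_nonneg h.pos.le hs
  intro l
  obtain ⟨hlo, hhi⟩ := abs_le.1 (hw l)
  have hsingle : (Pi.single i d : ι → ℝ) l ∈ Icc 0 d := by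
    rcases eq_or_ne l i with rfl | hl
    · simpa using hd
    · simpa [hl] using hd
  simp only [Pi.add_apply]
  constructor <;> linarith [hsingle.1, hsingle.2]

end cube

/-- The cube `[-ε, 1 + ε]^(3|ι|)`, its coordinates being arranged in three blocks. -/
def blockCube (ι : Type*) (ε : ℝ) : Set (Fin 3 → ι → ℝ) :=
  {x | ∀ b, x b ∈ cube ι ε 1}

/-- The centres of the cells of scale `q ^ j`. Block `0` is at the centre of the cube, and the other
blocks are near the corner `0`, so that there is room for a decrease by almost `1`. -/
structure IsCentre {ι : Type*} (ε q : ℝ) (j : ℕ) (a : Fin 3 → ι → ℝ) : Prop where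
  apply_zero : a 0 = fun _ ↦ 1 / 2
  mem_cube : ∀ b ≠ 0, a b ∈ cube ι ε (q ^ j)

namespace IsCentre

variable {ι : Type*} {ε q : ℝ} {j m : ℕ} {a : Fin 3 → ι → ℝ}

lemma mem_blockCube (h : SmallRatio ε q) (ha : IsCentre ε q j a) : a ∈ blockCube ι ε := by
  intro b
  rcases eq_or_ne b 0 with rfl | hb
  · rw [ha.apply_zero]
    exact half_mem_cube_one h.eps_pos.le
  · exact cube_mono h.eps_pos.le (pow_le_one₀ h.pos.le h.lt_one.le) (ha.mem_cube b hb)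

lemma anti (h : SmallRatio ε q) (ha : IsCentre ε q m a) (hjm : j ≤ m) : IsCentre ε q j a where
  apply_zero := ha.apply_zero
  mem_cube b hb := cube_mono h.eps_pos.le (h.pow_le_pow hjm) (ha.mem_cube b hb)

lemma update (ha : IsCentre ε q j a) {g : Fin 3} (hg : g ≠ 0) {v : ι → ℝ}
    (hv : v ∈ cube ι ε (q ^ j)) : IsCentre ε q j (Function.update a g v) where
  apply_zero := by rw [Function.update_of_ne hg.symm, ha.apply_zero]
  mem_cube b hb := by
    rcases eq_or_ne b g with rfl | hbg
    · rwa [Function.update_self]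
    · rw [Function.update_of_ne hbg]
      exact ha.mem_cube b hb

lemma single (h : SmallRatio ε q) (j : ℕ) :
    IsCentre ε q j (Pi.single 0 fun _ ↦ 1 / 2 : Fin 3 → ι → ℝ) where
  apply_zero := Pi.single_eq_same ..
  mem_cube b hb := by
    rw [Pi.single_eq_of_ne hb]
    exact zero_mem_cube h.eps_pos.le (pow_nonneg h.pos.le j)

lemma rescale_mem_cube_one (h : SmallRatio ε q) (ha : IsCentre ε q m a) {g : Fin 3}
    (hg : g = 0 ↔ m = 0) {t : ι → ℝ} (ht : t ∈ cube ι ε 1) :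
    rescale (q ^ m) (a g) t ∈ cube ι ε 1 := by
  rcases eq_or_ne m 0 with rfl | hm
  · rwa [hg.2 rfl, ha.apply_zero, pow_zero, rescale_one_half]
  · classical
    have hqm : q ^ m ≤ q := pow_le_of_le_one h.pos.le h.lt_one.le hm
    have hw : ∀ l, |rescale (q ^ m) (a g) t l| ≤ 3 * q * 1 := fun l ↦ by
      linarith [abs_rescale_le h.eps_lt.le (pow_nonneg h.pos.le m)
        (ha.mem_cube g (mt hg.1 hm)) ht l]
    intro i
    simpa using h.add_single_mem_cube zero_le_one hw le_rfl (by linarith [h.pos]) i i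

lemma rescale_add_single_mem_cube [DecidableEq ι] (h : SmallRatio ε q) (ha : IsCentre ε q m a)
    {g : Fin 3} (hg : g ≠ 0) {t : ι → ℝ} (ht : t ∈ cube ι ε 1) (hjm : j < m) (i : ι) :
    rescale (q ^ m) (a g) t + Pi.single i (∑ l ∈ Finset.Ico j m, q ^ l) ∈ cube ι ε (q ^ j) := by
  refine h.add_single_mem_cube (pow_nonneg h.pos.le j) ?_
    (Finset.sum_nonneg fun l _ ↦ pow_nonneg h.pos.le l)
    ((geom_sum_Ico_le_of_lt_one h.pos.le h.lt_one).trans (h.tail_le j)) i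
  intro l
  calc |rescale (q ^ m) (a g) t l| ≤ 3 * q ^ m :=
        abs_rescale_le h.eps_lt.le (pow_nonneg h.pos.le m) (ha.mem_cube g hg) ht l
    _ ≤ 3 * q ^ (j + 1) := mul_le_mul_of_nonneg_left (h.pow_le_pow hjm) zero_le_three
    _ = 3 * q * q ^ j := by ring

end IsCentre

lemma update_mem_blockCube {ι : Type*} {ε : ℝ} {a : Fin 3 → ι → ℝ} (ha : a ∈ blockCube ι ε)
    {v : ι → ℝ} (hv : v ∈ cube ι ε 1) (g : Fin 3) : Function.update a g v ∈ blockCube ι ε := by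
  intro b
  rcases eq_or_ne b g with rfl | hb
  · rwa [Function.update_self]
  · rw [Function.update_of_ne hb]
    exact ha b

section cell

variable {ι κ : Type*} [Fintype ι] {ε q : ℝ}

/-- The cell of scale `q ^ j` with centre `a` and pinned block `f`. Its radius exceeds `q ^ j / 2`,
but the radii at scales `q ^ j` and `q ^ (j + 1)` add up to at most `q ^ j`. -/
def cell (ε q : ℝ) (j : ℕ) (f : Fin 3) (a : Fin 3 → ι → ℝ) : Set (Fin 3 → ι → ℝ) :=
  {x ∈ blockCube ι ε | x f = a f ∧ dist x a ≤ (1 / 2 + ε) * q ^ j}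

/-- Every colour occurring in the cube occurs in all cells of scale `q ^ j` that have block `1` or
`2` pinned. -/
def AllCellsFull (ε q : ℝ) (c : (Fin 3 → ι → ℝ) → κ) (j : ℕ) : Prop :=
  ∀ f ≠ 0, ∀ a, IsCentre ε q j a → c '' blockCube ι ε ⊆ c '' cell ε q j f a

lemma cell_subset_blockCube (j : ℕ) (f : Fin 3) (a : Fin 3 → ι → ℝ) :
    cell ε q j f a ⊆ blockCube ι ε :=
  sep_subset _ _

lemma mem_cell_self (h : SmallRatio ε q) {a : Fin 3 → ι → ℝ} (ha : a ∈ blockCube ι ε) (j : ℕ)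
    (f : Fin 3) : a ∈ cell ε q j f a := by
  refine ⟨ha, rfl, ?_⟩
  have := h.eps_pos
  have := h.pos
  rw [dist_self]
  positivity

lemma IsDescent.of_mem_cell (h : SmallRatio ε q) {v : ℕ → ι → ℝ} {i : ι}
    (hv : IsDescent (fun u ↦ u i) (q ^ ·) v) {f : Fin 3} {a : Fin 3 → ι → ℝ}
    {x : ℕ → Fin 3 → ι → ℝ} (hx : ∀ j, x j ∈ cell ε q j f (Function.update a f (v j))) :
    IsDescent (fun y ↦ y f i) (q ^ ·) x := by
  have hpin : ∀ j, x j f = v j := fun j ↦ (hx j).2.1.trans (Function.update_self ..)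
  have hdist : ∀ j, ∀ b ≠ f, dist (x j b) (a b) ≤ (1 / 2 + ε) * q ^ j := fun j b hb ↦ by
    simpa only [Function.update_of_ne hb] using (dist_le_pi_dist _ _ b).trans (hx j).2.2
  refine ⟨fun j ↦ ?_, fun j ↦ (dist_pi_le_iff (pow_nonneg h.pos.le j)).2 fun b ↦ ?_⟩
  · simpa only [hpin] using hv.apply_succ j
  · rcases eq_or_ne b f with rfl | hb
    · simpa only [hpin] using hv.dist_succ_le j
    · calc dist (x j b) (x (j + 1) b)
          ≤ dist (x j b) (a b) + dist (x (j + 1) b) (a b) := dist_triangle_right _ _ _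
        _ ≤ (1 / 2 + ε) * q ^ j + (1 / 2 + ε) * q ^ (j + 1) :=
          add_le_add (hdist j b hb) (hdist (j + 1) b hb)
        _ ≤ q ^ j := h.radius_add_radius_succ_le j

lemma containsDescent_of_forall_mem_image_cell (h : SmallRatio ε q) {v : ℕ → ι → ℝ} {i : ι}
    (hv : IsDescent (fun u ↦ u i) (q ^ ·) v) {f : Fin 3} {a : Fin 3 → ι → ℝ}
    {c : (Fin 3 → ι → ℝ) → κ} {y : κ}
    (hy : ∀ j, y ∈ c '' cell ε q j f (Function.update a f (v j))) :
    ContainsDescent (fun (p : Fin 3 × ι) x ↦ x p.1 p.2) q (blockCube ι ε ∩ c ⁻¹' {y}) := by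
  choose x hx hxc using hy
  exact ⟨(f, i), x, hv.of_mem_cell h hx, fun j ↦ ⟨cell_subset_blockCube _ _ _ (hx j), hxc j⟩⟩

lemma containsDescent_of_allCellsFull [Nonempty ι] (h : SmallRatio ε q)
    {c : (Fin 3 → ι → ℝ) → κ} (hfull : ∀ j, AllCellsFull ε q c j) {y : κ}
    (hy : y ∈ c '' blockCube ι ε) :
    ContainsDescent (fun (p : Fin 3 × ι) x ↦ x p.1 p.2) q (blockCube ι ε ∩ c ⁻¹' {y}) := by
  classical
  obtain ⟨i⟩ := ‹Nonempty ι›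
  refine containsDescent_of_forall_mem_image_cell h (h.isDescent_single_tail i) (f := 1)
    (a := Pi.single 0 fun _ ↦ 1 / 2) fun j ↦ ?_
  have hqj : 0 ≤ q ^ j := pow_nonneg h.pos.le j
  have htail : Pi.single i (q ^ j / (1 - q)) ∈ cube ι ε (q ^ j) := by
    simpa using h.add_single_mem_cube hqj (w := 0)
      (fun _ ↦ by simpa [mul_assoc] using mul_nonneg h.pos.le hqj) (h.tail_nonneg j) (h.tail_le j) i
  exact hfull j 1 (by decide) _ ((IsCentre.single h j).update (by decide) htail) hy

lemma IsCentre.update_rescale_mem_cell (h : SmallRatio ε q) {m : ℕ} {a : Fin 3 → ι → ℝ}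
    (ha : IsCentre ε q m a) {f g : Fin 3} (hgf : g ≠ f) (hg : g = 0 ↔ m = 0) {t : ι → ℝ}
    (ht : t ∈ cube ι ε 1) :
    Function.update a g (rescale (q ^ m) (a g) t) ∈ cell ε q m f a := by
  have hε := h.eps_pos.le
  have hqm : 0 ≤ q ^ m := pow_nonneg h.pos.le m
  refine ⟨update_mem_blockCube (ha.mem_blockCube h) (ha.rescale_mem_cube_one h hg ht) g,
    Function.update_of_ne hgf.symm _ _, (dist_pi_le_iff (by positivity)).2 fun b ↦ ?_⟩
  rcases eq_or_ne b g with rfl | hb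
  · rw [Function.update_self]
    exact (dist_pi_le_iff (by positivity)).2 fun i ↦ abs_rescale_sub_le hqm _ ht i
  · rw [Function.update_of_ne hb, dist_self]
    positivity

end cell

section induction

variable {ι κ : Type*} [Fintype ι] {ε q : ℝ} {k : ℕ}

lemma encard_le_of_ssubset_of_encard_le_add_one {α : Type*} {s t : Set α} (hst : s ⊂ t)
    (ht : t.encard ≤ k + 1) : s.encard ≤ k := by
  have hfin : t.Finite := finite_of_encard_le_coe (k := k + 1) (by exact_mod_cast ht)
  have hlt : s.encard < t.encard := (hfin.subset hst.subset).encard_lt_encard hst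
  exact (ENat.lt_add_one_iff (ENat.natCast_ne_top k)).1 (hlt.trans_le ht)

lemma exists_block_ne (f : Fin 3) (hf : f ≠ 0) (m : ℕ) : ∃ g ≠ f, (g = 0 ↔ m = 0) := by
  rcases eq_or_ne m 0 with rfl | hm
  · exact ⟨0, hf.symm, by simp⟩
  · obtain ⟨g, hgf, hg⟩ : ∃ g : Fin 3, g ≠ f ∧ g ≠ 0 := by decide +revert
    exact ⟨g, hgf, by simp [hg, hm]⟩

lemma HasMonochromaticDescent.exists_isDescent_rescale (h : SmallRatio ε q)
    (ih : HasMonochromaticDescent κ (fun i (u : ι → ℝ) ↦ u i) q (cube ι ε 1) k)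
    {c : (Fin 3 → ι → ℝ) → κ} (hc : (c '' blockCube ι ε).encard ≤ k + 1) {m : ℕ} {f g : Fin 3}
    {a : Fin 3 → ι → ℝ} (ha : IsCentre ε q m a) (hgf : g ≠ f) (hg : g = 0 ↔ m = 0)
    (hmiss : ¬ c '' blockCube ι ε ⊆ c '' cell ε q m f a) :
    ∃ (y : κ) (i : ι) (t : ℕ → ι → ℝ), (∀ l, t l ∈ cube ι ε 1) ∧
      IsDescent (fun u ↦ u i) (fun l ↦ q ^ (m + l)) (fun l ↦ rescale (q ^ m) (a g) (t l)) ∧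
      ∀ l, c (Function.update a g (rescale (q ^ m) (a g) (t l))) = y := by
  let c' : (ι → ℝ) → κ := fun t ↦ c (Function.update a g (rescale (q ^ m) (a g) t))
  have hsubset : c' '' cube ι ε 1 ⊆ c '' cell ε q m f a :=
    image_subset_iff.2 fun t ht ↦ mem_image_of_mem c (ha.update_rescale_mem_cell h hgf hg ht)
  have hfew : (c '' cell ε q m f a).encard ≤ k :=
    encard_le_of_ssubset_of_encard_le_add_one
      ⟨image_mono (cell_subset_blockCube m f a), hmiss⟩ hc
  obtain ⟨y, i, t, ht, htQ⟩ := ih c' ((encard_le_encard hsubset).trans hfew)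
  refine ⟨y, i, t, fun l ↦ (htQ l).1, ?_, fun l ↦ (htQ l).2⟩
  simpa only [pow_add, rescale] using ht.add_smul_sub (pow_nonneg h.pos.le m) (a g) fun _ ↦ 1 / 2

lemma HasMonochromaticDescent.to_blockCube [Nonempty ι] (h : SmallRatio ε q)
    (ih : HasMonochromaticDescent κ (fun i (u : ι → ℝ) ↦ u i) q (cube ι ε 1) k) :
    HasMonochromaticDescent κ (fun (p : Fin 3 × ι) x ↦ x p.1 p.2) q (blockCube ι ε) (k + 1) := by
  classical
  intro c hc
  by_cases hfull : ∀ j, AllCellsFull ε q c j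
  · exact ⟨_, containsDescent_of_allCellsFull h hfull
      (mem_image_of_mem c fun _ ↦ half_mem_cube_one h.eps_pos.le)⟩
  obtain ⟨m, hm, hmin⟩ : ∃ m, ¬ AllCellsFull ε q c m ∧ ∀ j < m, AllCellsFull ε q c j := by
    push Not at hfull
    exact ⟨Nat.find hfull, Nat.find_spec hfull, fun j hj ↦ not_not.1 (Nat.find_min hfull hj)⟩
  obtain ⟨f, hf, a, ha, hmiss⟩ : ∃ f ≠ 0, ∃ a, IsCentre ε q m a ∧
      ¬ c '' blockCube ι ε ⊆ c '' cell ε q m f a := by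
    simpa only [AllCellsFull, not_forall, exists_prop] using hm
  obtain ⟨g, hgf, hg⟩ := exists_block_ne f hf m
  obtain ⟨y, i, t, ht, hdesc, hcol⟩ :=
    ih.exists_isDescent_rescale h (by exact_mod_cast hc) ha hgf hg hmiss
  have hmem : ∀ l, Function.update a g (rescale (q ^ m) (a g) (t l)) ∈ blockCube ι ε :=
    fun l ↦ cell_subset_blockCube m f a (ha.update_rescale_mem_cell h hgf hg (ht l))
  refine ⟨y, containsDescent_of_forall_mem_image_cell h
    (hdesc.prolong fun l ↦ pow_nonneg h.pos.le l) (f := g) (a := a) fun j ↦ ?_⟩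
  rcases lt_or_ge j m with hjm | hmj
  · have hg0 : g ≠ 0 := fun h0 ↦ (hg.1 h0 ▸ hjm).not_ge (Nat.zero_le j)
    rw [Nat.sub_eq_zero_of_le hjm.le]
    exact hmin j hjm g hg0 _
      ((ha.anti h hjm.le).update hg0 (ha.rescale_add_single_mem_cube h hg0 (ht 0) hjm i))
      ⟨_, hmem 0, hcol 0⟩
  · rw [Finset.Ico_eq_empty_of_le hmj, Finset.sum_empty, Pi.single_zero, add_zero]
    exact ⟨_, mem_cell_self h (hmem (j - m)) j g, hcol (j - m)⟩

lemma HasMonochromaticDescent.cube_of_blockCube {ι' : Type*} [Fintype ι'] (e : ι' ≃ Fin 3 × ι)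
    (hQ : HasMonochromaticDescent κ (fun (p : Fin 3 × ι) x ↦ x p.1 p.2) q (blockCube ι ε) k) :
    HasMonochromaticDescent κ (fun i (u : ι' → ℝ) ↦ u i) q (cube ι' ε 1) k :=
  hQ.map_isometry ((isometry_comp_of_surjective e.surjective).comp isometry_uncurry)
    (fun _ hx i ↦ hx (e i).1 (e i).2) e.symm fun p x ↦ by simp [Function.uncurry]

theorem SmallRatio.hasMonochromaticDescent_epsCube (h : SmallRatio ε q) (κ : Type*) (k : ℕ) :
    HasMonochromaticDescent κ (fun i (u : Fin (3 ^ k) → ℝ) ↦ u i) q (epsCube (3 ^ k) ε) k := by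
  rw [← cube_one_eq_epsCube]
  induction k with
  | zero =>
    intro c hc
    have hempty : c '' cube (Fin (3 ^ 0)) ε 1 = ∅ := encard_eq_zero.1 (by simpa using hc)
    exact absurd (hempty ▸ mem_image_of_mem c (half_mem_cube_one h.eps_pos.le)) (notMem_empty _)
  | succ k ih =>
    have e : Fin (3 ^ (k + 1)) ≃ Fin 3 × Fin (3 ^ k) :=
      Fintype.equivOfCardEq (by simp [pow_succ'])
    exact (ih.to_blockCube h).cube_of_blockCube e

end induction

section conclusion

variable {ε q : ℝ}

theorem exists_monochromatic_properCopy (h : SmallRatio ε q) (k : ℕ)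
    (c : epsCube (3 ^ k) ε → Fin k) :
    ∃ C : Set (epsCube (3 ^ k) ε), IsMonochromatic c C ∧ IsProperCopy q (Subtype.val '' C) := by
  have hhalf : (fun _ ↦ 1 / 2) ∈ epsCube (3 ^ k) ε :=
    cube_one_eq_epsCube (3 ^ k) ε ▸ half_mem_cube_one h.eps_pos.le
  let c' := Function.extend Subtype.val c fun _ ↦ c ⟨_, hhalf⟩
  have hc' : (c' '' epsCube (3 ^ k) ε).encard ≤ k := by
    simpa using encard_le_encard (subset_univ (c' '' epsCube (3 ^ k) ε))
  obtain ⟨a, i, x, hx, hxQ⟩ := h.hasMonochromaticDescent_epsCube (Fin k) k c' hc'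
  refine ⟨range fun l ↦ ⟨x l, (hxQ l).1⟩, ⟨a, forall_mem_range.2 fun l ↦ ?_⟩, ?_⟩
  · exact (Subtype.val_injective.extend_apply c _ ⟨x l, (hxQ l).1⟩).symm.trans (hxQ l).2
  · rw [← range_comp]
    exact hx.isProperCopy_range h.pos

lemma not_avoidsWithColours_geomProg (h : SmallRatio ε q) (k : ℕ) :
    ¬ AvoidsWithColours (Fin (3 ^ k) → ℝ) (geomProg q) k := by
  rintro ⟨c, hc⟩
  obtain ⟨C, hmono, hC, -⟩ := exists_monochromatic_properCopy h k (c ∘ Subtype.val)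
  exact hc _ hC hmono.image

lemma lt_metricChromaticNumber_geomProg (h : SmallRatio ε q) {k n : ℕ} (hkn : 3 ^ k ≤ n) :
    (k : ℕ∞) < metricChromaticNumber (Fin n → ℝ) (geomProg q) := by
  have : Nonempty (geomProg q) := (range_nonempty _).to_subtype
  have : Nonempty (Fin (3 ^ k)) := ⟨⟨0, by positivity⟩⟩
  have hσ := Function.invFun_surjective (Fin.castLE_injective hkn)
  exact (lt_metricChromaticNumber (not_avoidsWithColours_geomProg h k)).trans_le
    (metricChromaticNumber_le_of_isometry (isometry_comp_of_surjective hσ))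

lemma logb_lt_metricChromaticNumber_geomProg (h : SmallRatio ε q) {n : ℕ} (hn : 1 ≤ n) :
    ENNReal.ofReal (Real.logb 3 n) <
      (metricChromaticNumber (Fin n → ℝ) (geomProg q) : ℝ≥0∞) := by
  have hlog : ((Nat.log 3 n + 1 : ℕ) : ℕ∞) ≤ metricChromaticNumber (Fin n → ℝ) (geomProg q) := by
    have := lt_metricChromaticNumber_geomProg h (Nat.pow_log_le_self 3 (by omega : n ≠ 0))
    exact_mod_cast Order.add_one_le_of_lt this
  calc ENNReal.ofReal (Real.logb 3 n) < ((Nat.log 3 n + 1 : ℕ) : ℝ≥0∞) := by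
        rw [← ENNReal.ofReal_natCast, ENNReal.ofReal_lt_ofReal_iff (by positivity),
          Real.logb_lt_iff_lt_rpow (by norm_num) (by exact_mod_cast hn), Real.rpow_natCast]
        exact_mod_cast Nat.lt_pow_succ_log_self (by norm_num) n
    _ ≤ metricChromaticNumber (Fin n → ℝ) (geomProg q) := by
        simpa using ENat.toENNReal_le.2 hlog

lemma isLInftyRamsey_geomProg (h : SmallRatio ε q) : IsLInftyRamsey (geomProg q) := by
  refine ENat.tendsto_nhds_top_iff_natCast_lt.2 fun k ↦ ?_
  filter_upwards [eventually_ge_atTop (3 ^ k)] with n hn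
  exact lt_metricChromaticNumber_geomProg h hn

end conclusion

theorem theorem7 :
    (∀ ε : ℝ, 0 < ε → ε < 1 / 2 →
      ∃ q₀ : ℝ, 0 < q₀ ∧ ∀ q : ℝ, 0 < q → q ≤ q₀ →
        ∀ (k : ℕ) (c : epsCube (3 ^ k) ε → Fin k),
          ∃ C : Set (epsCube (3 ^ k) ε),
            IsMonochromatic c C ∧ IsProperCopy q (Subtype.val '' C)) ∧
    (∃ q₀ : ℝ, 0 < q₀ ∧ ∀ q : ℝ, 0 < q → q ≤ q₀ →
      ∀ n : ℕ, 1 ≤ n →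
        ENNReal.ofReal (Real.logb 3 n) <
          (metricChromaticNumber (Fin n → ℝ) (geomProg q) : ℝ≥0∞)) ∧
    (∃ (M : Type) (_ : MetricSpace M), Infinite M ∧ IsLInftyRamsey M) := by
  refine ⟨fun ε hε hε' ↦ ?_, ?_, ?_⟩
  · obtain ⟨q₀, hq₀, hsmall⟩ := exists_smallRatio hε hε'
    exact ⟨q₀, hq₀, fun q hq hle ↦ exists_monochromatic_properCopy (hsmall q hq hle)⟩
  · obtain ⟨q₀, hq₀, hsmall⟩ := exists_smallRatio (ε := 1 / 4) (by norm_num) (by norm_num)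
    exact ⟨q₀, hq₀, fun q hq hle n hn ↦
      logb_lt_metricChromaticNumber_geomProg (hsmall q hq hle) hn⟩
  · obtain ⟨q, hq, hsmall⟩ := exists_smallRatio (ε := 1 / 4) (by norm_num) (by norm_num)
    exact ⟨geomProg q, inferInstance, infinite_geomProg hq,
      isLInftyRamsey_geomProg (hsmall q hq le_rfl)⟩
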